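/- **Theorem 6.1.** Let $G$ be a locally compact (Hausdorff) group and $\mu$ a regular Borel probability measure on $G$. Let $E$ be the dual of a separable complex Banach space $E_*$, with pairing $\langle x_*,x\rangle$. Let $\pi_*$ be a strongly continuous representation of $G$ by (surjective linear) isometries of $E_*$, and let $\pi(g)=[\pi_*(g^{-1})]^*$ be the adjoint representation in $E$. Let $\mathcal H_{\mu\pi}\subseteq E$ be the space of $\mu$-harmonic vectors, i.e. of those $x\in E$ with $\langle x_*,x\rangle=\int_G\langle x_*,\pi(g)x\rangle\,\mu(dg)$ for all $x_*\in E_*$. Let $G^\infty=\prod_{n\ge 0}G$ with the product $\mathcal B^\infty$ of the Borel $\sigma$-algebras. For $g\in G$ let $Q_g$ be the law on $(G^\infty,\mathcal B^\infty)$ of the right random walk of law $\mu$ started at $g$, i.e. of the Markov chain with transition probability $\Pi(g,A)=\mu(g^{-1}A)$. Let $\vartheta(\omega_0,\omega_1,\dots)=(\omega_1,\omega_2,\dots)$, let $\mathcal B^{(i)}=\{A\in\mathcal B^\infty:\vartheta^{-1}(A)=A\}$, and let $G$ act on $G^\infty$ by $g(\omega_n)_n=(g\omega_n)_n$. A set $A\in\mathcal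 B^{(i)}$ is universally null (universally conull) if $Q_g(A)=0$ (resp. $Q_g(A)=1$) for every $g\in G$; a property holds universally almost everywhere (u.a.e.) if it holds on a universally conull set. An $E$-valued invariant random variable is a function $f:G^\infty\to E$ such that $\omega\mapsto\langle x_*,f(\omega)\rangle$ is $\mathcal B^{(i)}$-measurable for every $x_*\in E_*$. It is universally essentially bounded if $$\|f\|_u=\inf_{\Delta\ \text{universally null}}\ \sup_{\omega\in G^\infty\setminus\Delta}\|f(\omega)\|<\infty .$$ Let $\mathbb L^\infty_i(\mu,E)$ be the normed space, with norm $\|\cdot\|_u$, of universally essentially bounded $E$-valued invariant random variables modulo equality u.a.e., and let $\mathbb L_{\mu\pi}$ be the subspace of the classes of those $f$ such that for every $g\in G$, $f(g\omega)=\pi(g)f(\omega)$ for u.a.e. $\omega$ (that is, $g^{-1}f=\hat\pi(g)f$ in $\mathbb L^\infty_i(\mu,E)$). Then the mapping $R_\pi:\mathbb L_{\mu\pi}\to E$, $$R_\pi f=\int_{G^\infty}f(\omega)\,Q_e(d\omega)\qquad\text{(weak* integral)},$$ is an isometric linear isomorphism of $\mathbb L_{\mu\pi}$ onto $\mathcal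 H_{\mu\pi}$. Furthermore, for every $x\in\mathcal H_{\mu\pi}$ the sequence $\pi(\omega_n)x$ converges weak* u.a.e. to $R_\pi^{-1}x$ (for any representative of the class $R_\pi^{-1}x$). -/

import Mathlib

open MeasureTheory ProbabilityTheory Filter Set Topology
open scoped ENNReal

noncomputable section

namespace ChoquetDeny

/-! ### The right random walk of law `μ` on `G` -/

section RandomWalk

variable {G : Type*} [Group G] [TopologicalSpace G] [IsTopologicalGroup G]
  [MeasurableSpace G]

theorem lowerSemicontinuous_translate (μ : Measure G) [μ.Regular] {U : Set G} (hU : IsOpen U) :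
    LowerSemicontinuous (fun g : G => μ ((fun x => g * x) ⁻¹' U)) := by
  intro g c hc
  have hUg : IsOpen ((fun x => g * x) ⁻¹' U) := hU.preimage (continuous_const_mul g)
  obtain ⟨K, hK, hKc, hcK⟩ := hUg.exists_lt_isCompact hc
  have hev : ∀ᶠ g' in 𝓝 g, ∀ x ∈ K, g' * x ∈ U := by
    refine hKc.eventually_forall_of_forall_eventually (fun x hx => ?_)
    exact (continuous_mul.tendsto (g, x)).eventually (hU.mem_nhds (hK hx))
  filter_upwards [hev] with g' hg'
  exact hcK.trans_le (measure_mono hg')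

variable [BorelSpace G]

/-- The transition probability `Π(g, A) = μ(g⁻¹A)` of the right random walk of law `μ`. -/
def stepKernel (μ : Measure G) [IsProbabilityMeasure μ] [μ.Regular] : Kernel G G where
  toFun g := μ.map (fun x => g * x)
  measurable' := by
    have hp : ∀ g : G, IsProbabilityMeasure (μ.map (fun x => g * x)) := fun g =>
      Measure.isProbabilityMeasure_map (measurable_const_mul g).aemeasurable
    refine Measurable.measure_of_isPiSystem_of_isProbabilityMeasure
      (S := {s : Set G | IsOpen s}) (BorelSpace.measurable_eq) isPiSystem_isOpen ?_
    intro s hs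
    have : (fun g : G => (μ.map (fun x => g * x)) s) =
        fun g : G => μ ((fun x => g * x) ⁻¹' s) := by
      funext g
      exact Measure.map_apply (measurable_const_mul g) (IsOpen.measurableSet hs)
    rw [this]
    exact (lowerSemicontinuous_translate μ hs).measurable

variable (μ : Measure G) [IsProbabilityMeasure μ] [μ.Regular]

theorem stepKernel_apply (g : G) : stepKernel μ g = μ.map (fun x => g * x) := rfl

instance : IsMarkovKernel (stepKernel μ) :=
  ⟨fun g => Measure.isProbabilityMeasure_map (measurable_const_mul g).aemeasurable⟩

/-- The transition from the history `(ω₀, …, ωₙ)` to `ωₙ₊₁`: it depends on `ωₙ` only. -/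
def historyKernel (n : ℕ) : Kernel (Π _ : Finset.Iic n, G) G :=
  (stepKernel μ).comap (fun p => p ⟨n, Finset.mem_Iic.2 le_rfl⟩) (measurable_pi_apply _)

instance (n : ℕ) : IsMarkovKernel (historyKernel μ n) := by
  unfold historyKernel; infer_instance

/-- The Markov measure `Q_g` on the path space `G^∞ = ℕ → G` with its product `σ`-algebra: the law
of the right random walk of law `μ` started at `g`. -/
def markovMeasure (g : G) : Measure (ℕ → G) :=
  Kernel.traj (X := fun _ => G) (historyKernel μ) 0 (fun _ => g)

instance (g : G) : IsProbabilityMeasure (markovMeasure μ g) := by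
  unfold markovMeasure; infer_instance

/-- The Markov shift `ϑ` on the path space. -/
def shift (ω : ℕ → G) : ℕ → G := fun n => ω (n + 1)

/-- Universally conull sets: members of the invariant `σ`-algebra `B⁽ⁱ⁾ = {A : ϑ⁻¹A = A}` with
`Q_g(A) = 1` for every `g`. -/
def UnivConull (A : Set (ℕ → G)) : Prop :=
  MeasurableSet[MeasurableSpace.invariants (shift (G := G))] A ∧ ∀ g, markovMeasure μ g A = 1

/-- A path property holds universally almost everywhere: it holds on a universally conull set. -/
def UAE (p : (ℕ → G) → Prop) : Prop := ∃ A, UnivConull μ A ∧ ∀ ω ∈ A, p ω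

/-- Universally null sets: members of `B⁽ⁱ⁾` that are `Q_g`-null for every `g`. -/
def UnivNull (A : Set (ℕ → G)) : Prop :=
  MeasurableSet[MeasurableSpace.invariants (shift (G := G))] A ∧ ∀ g, markovMeasure μ g A = 0

variable {μ}

theorem UnivNull.empty : UnivNull μ (∅ : Set (ℕ → G)) :=
  ⟨@MeasurableSet.empty _ (MeasurableSpace.invariants shift), fun _ => measure_empty⟩

theorem UnivNull.union {A B : Set (ℕ → G)} (hA : UnivNull μ A) (hB : UnivNull μ B) :
    UnivNull μ (A ∪ B) :=
  ⟨MeasurableSet.union hA.1 hB.1, fun g => measure_union_null (hA.2 g) (hB.2 g)⟩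

theorem UnivNull.iUnion {A : ℕ → Set (ℕ → G)} (hA : ∀ n, UnivNull μ (A n)) :
    UnivNull μ (⋃ n, A n) :=
  ⟨MeasurableSet.iUnion fun n => (hA n).1, fun g => measure_iUnion_null fun n => (hA n).2 g⟩

theorem UnivConull.compl {A : Set (ℕ → G)} (hA : UnivConull μ A) : UnivNull μ Aᶜ :=
  ⟨hA.1.compl, fun g => by
    rw [prob_compl_eq_zero_iff (MeasurableSpace.invariants_le _ _ hA.1)]; exact hA.2 g⟩

theorem UnivNull.compl {A : Set (ℕ → G)} (hA : UnivNull μ A) : UnivConull μ Aᶜ :=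
  ⟨hA.1.compl, fun g => by
    rw [prob_compl_eq_one_iff (MeasurableSpace.invariants_le _ _ hA.1)]; exact hA.2 g⟩

theorem uae_iff_null {p : (ℕ → G) → Prop} :
    UAE μ p ↔ ∃ A, UnivNull μ A ∧ ∀ ω ∉ A, p ω := by
  constructor
  · rintro ⟨A, hA, h⟩
    exact ⟨Aᶜ, hA.compl, fun ω hω => h ω (by simpa using hω)⟩
  · rintro ⟨A, hA, h⟩
    exact ⟨Aᶜ, hA.compl, fun ω hω => h ω hω⟩

theorem UAE.ae {p : (ℕ → G) → Prop} (h : UAE μ p) (g : G) : ∀ᵐ ω ∂(markovMeasure μ g), p ω := by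
  obtain ⟨A, hA, h⟩ := uae_iff_null.1 h
  exact measure_mono_null (fun ω hω => by_contra fun hn => hω (h ω hn)) (hA.2 g)

theorem UAE.and {p q : (ℕ → G) → Prop} (hp : UAE μ p) (hq : UAE μ q) :
    UAE μ (fun ω => p ω ∧ q ω) := by
  rw [uae_iff_null] at *
  obtain ⟨A, hA, h⟩ := hp
  obtain ⟨B, hB, h'⟩ := hq
  exact ⟨A ∪ B, hA.union hB, fun ω hω => ⟨h ω fun hh => hω (.inl hh), h' ω fun hh => hω (.inr hh)⟩⟩

theorem UAE.mono {p q : (ℕ → G) → Prop} (hp : UAE μ p) (h : ∀ ω, p ω → q ω) : UAE μ q := by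
  obtain ⟨A, hA, hp⟩ := hp
  exact ⟨A, hA, fun ω hω => h ω (hp ω hω)⟩

theorem UAE.of_forall {p : (ℕ → G) → Prop} (h : ∀ ω, p ω) : UAE μ p :=
  uae_iff_null.2 ⟨∅, UnivNull.empty, fun ω _ => h ω⟩

end RandomWalk

/-! Shortcuts for instance search (these are Mathlib's instances). -/

section Shortcuts

variable {F : Type*} [NormedAddCommGroup F] [NormedSpace ℂ F]

instance : NormedAddCommGroup (StrongDual ℂ F) := inferInstance

instance : AddCommGroup (StrongDual ℂ F) := inferInstance

end Shortcuts

/-! ### The weak* integral in a dual space -/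

section WeakStarIntegral

variable {Ω : Type*} [MeasurableSpace Ω] {F : Type*} [NormedAddCommGroup F] [NormedSpace ℂ F]

/-- `y = ∫ f dσ` in the weak* sense: `⟨v, y⟩ = ∫ ⟨v, f(t)⟩ σ(dt)` for every `v` in the predual
(with convergent integrals). -/
def IsWeakStarIntegral (σ : Measure Ω) (f : Ω → StrongDual ℂ F) (y : StrongDual ℂ F) : Prop :=
  ∀ v : F, Integrable (fun t => f t v) σ ∧ y v = ∫ t, f t v ∂σ

theorem IsWeakStarIntegral.unique {σ : Measure Ω} {f : Ω → StrongDual ℂ F}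
    {y z : StrongDual ℂ F} (hy : IsWeakStarIntegral σ f y) (hz : IsWeakStarIntegral σ f z) :
    y = z := by
  ext v
  rw [(hy v).2, (hz v).2]

theorem IsWeakStarIntegral.add {σ : Measure Ω} {f g : Ω → StrongDual ℂ F}
    {y z : StrongDual ℂ F} (hy : IsWeakStarIntegral σ f y) (hz : IsWeakStarIntegral σ g z) :
    IsWeakStarIntegral σ (f + g) (y + z) := fun v =>
  ⟨(hy v).1.add (hz v).1, by
    change y v + z v = ∫ t, (f t v + g t v) ∂σ
    rw [integral_add (hy v).1 (hz v).1, (hy v).2, (hz v).2]⟩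

theorem IsWeakStarIntegral.smul {σ : Measure Ω} {f : Ω → StrongDual ℂ F}
    {y : StrongDual ℂ F} (c : ℂ) (hy : IsWeakStarIntegral σ f y) :
    IsWeakStarIntegral σ (c • f) (c • y) := fun v =>
  ⟨(hy v).1.smul c, by
    change c • y v = ∫ t, c • f t v ∂σ
    rw [integral_smul, (hy v).2]⟩

theorem IsWeakStarIntegral.zero {σ : Measure Ω} :
    IsWeakStarIntegral σ (0 : Ω → StrongDual ℂ F) 0 := fun v =>
  ⟨by simp, by simp⟩

theorem exists_isWeakStarIntegral (σ : Measure Ω) [IsFiniteMeasure σ] {f : Ω → StrongDual ℂ F}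
    (hf : ∀ v, Measurable fun t => f t v) {C : ℝ} (hC : ∀ᵐ t ∂σ, ‖f t‖ ≤ C) :
    ∃ y, IsWeakStarIntegral σ f y := by
  have hb : ∀ v, ∀ᵐ t ∂σ, ‖f t v‖ ≤ C * ‖v‖ := fun v => hC.mono fun t ht =>
    ((f t).le_opNorm v).trans (mul_le_mul_of_nonneg_right ht (norm_nonneg v))
  have hi : ∀ v, Integrable (fun t => f t v) σ := fun v =>
    Integrable.of_bound (hf v).aestronglyMeasurable (C * ‖v‖) (hb v)
  let L : F →ₗ[ℂ] ℂ :=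
    { toFun := fun v => ∫ t, f t v ∂σ
      map_add' := fun v w => by simp only [map_add]; exact integral_add (hi v) (hi w)
      map_smul' := fun c v => by
        simp only [map_smul, RingHom.id_apply]; exact integral_smul c _ }
  refine ⟨L.mkContinuous (C * σ.real univ) fun v => ?_, fun v => ⟨hi v, rfl⟩⟩
  refine (norm_integral_le_of_norm_le_const (hb v)).trans (le_of_eq ?_)
  ring

open Classical in
/-- The weak* integral (`0` when it does not exist). -/
def weakStarIntegral (σ : Measure Ω) (f : Ω → StrongDual ℂ F) : StrongDual ℂ F :=
  if h : ∃ y, IsWeakStarIntegral σ f y then h.choose else 0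

theorem weakStarIntegral_spec {σ : Measure Ω} {f : Ω → StrongDual ℂ F}
    (h : ∃ y, IsWeakStarIntegral σ f y) : IsWeakStarIntegral σ f (weakStarIntegral σ f) := by
  unfold weakStarIntegral
  rw [dif_pos h]
  exact h.choose_spec

theorem IsWeakStarIntegral.eq {σ : Measure Ω} {f : Ω → StrongDual ℂ F} {y : StrongDual ℂ F}
    (h : IsWeakStarIntegral σ f y) : weakStarIntegral σ f = y :=
  (weakStarIntegral_spec ⟨y, h⟩).unique h

end WeakStarIntegral

/-! ### Universally essentially bounded invariant random variables

The Banach space `E` with predual `F` is `StrongDual ℂ F`. -/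

section Linfty

variable {G : Type*} [Group G] [TopologicalSpace G] [IsTopologicalGroup G]
  [MeasurableSpace G] [BorelSpace G] (μ : Measure G) [IsProbabilityMeasure μ] [μ.Regular]
  (F : Type*) [NormedAddCommGroup F] [NormedSpace ℂ F]

variable {F} in
/-- `E`-valued invariant random variables: `B⁽ⁱ⁾`-measurable functions `f : G^∞ → E`. For a
separable predual the Borel structure of the weak* topology of `E` is generated by the
functionals `⟨v, ·⟩`, so measurability is tested on these. -/
def IsInvariantRV (f : (ℕ → G) → StrongDual ℂ F) : Prop :=
  ∀ v : F, Measurable[MeasurableSpace.invariants (shift (G := G))] fun ω => f ω v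

variable {F} in
/-- `‖f‖_u`, the infimum over universally null `Δ` of `sup_{ω ∉ Δ} ‖f(ω)‖`, in `[0, ∞]`. -/
def uENorm (f : (ℕ → G) → StrongDual ℂ F) : ℝ≥0∞ :=
  ⨅ (Δ : Set (ℕ → G)) (_ : UnivNull μ Δ), ⨆ ω ∈ Δᶜ, ‖f ω‖ₑ

variable {F} {μ}

theorem uENorm_le {f : (ℕ → G) → StrongDual ℂ F} {c : ℝ≥0∞} (h : UAE μ fun ω => ‖f ω‖ₑ ≤ c) :
    uENorm μ f ≤ c := by
  obtain ⟨Δ, hΔ, h⟩ := uae_iff_null.1 h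
  exact iInf₂_le_of_le Δ hΔ (iSup₂_le fun ω hω => h ω hω)

theorem uae_le_uENorm (f : (ℕ → G) → StrongDual ℂ F) :
    UAE μ fun ω => ‖f ω‖ₑ ≤ uENorm μ f := by
  rw [uae_iff_null]
  by_cases htop : uENorm μ f = ∞
  · exact ⟨∅, UnivNull.empty, fun ω _ => by simp [htop]⟩
  obtain ⟨u, -, hu, hlim⟩ := exists_seq_strictAnti_tendsto' (lt_top_iff_ne_top.2 htop)
  have key : ∀ n, ∃ Δ, UnivNull μ Δ ∧ ∀ ω ∉ Δ, ‖f ω‖ₑ ≤ u n := by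
    intro n
    have hlt : uENorm μ f < u n := (hu n).1
    unfold uENorm at hlt
    simp only [iInf_lt_iff] at hlt
    obtain ⟨Δ, hΔ, h⟩ := hlt
    exact ⟨Δ, hΔ, fun ω hω => (le_iSup₂_of_le (f := fun ω _ => ‖f ω‖ₑ) ω hω le_rfl).trans h.le⟩
  choose Δ hΔ h using key
  refine ⟨⋃ n, Δ n, UnivNull.iUnion hΔ, fun ω hω => ?_⟩
  refine ge_of_tendsto' hlim fun n => h n ω fun hn => hω (mem_iUnion.2 ⟨n, hn⟩)

theorem uENorm_congr {f g : (ℕ → G) → StrongDual ℂ F} (h : UAE μ fun ω => f ω = g ω) :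
    uENorm μ f = uENorm μ g := by
  refine le_antisymm (uENorm_le ?_) (uENorm_le ?_)
  · exact (h.and (uae_le_uENorm g)).mono fun ω hω => by rw [hω.1]; exact hω.2
  · exact (h.and (uae_le_uENorm f)).mono fun ω hω => by rw [← hω.1]; exact hω.2

theorem uENorm_add_le (f g : (ℕ → G) → StrongDual ℂ F) :
    uENorm μ (f + g) ≤ uENorm μ f + uENorm μ g :=
  uENorm_le (((uae_le_uENorm f).and (uae_le_uENorm g)).mono fun ω hω =>
    (enorm_add_le (f ω) (g ω)).trans (add_le_add hω.1 hω.2))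

theorem uENorm_smul_le (c : ℂ) (f : (ℕ → G) → StrongDual ℂ F) :
    uENorm μ (c • f) ≤ ‖c‖ₑ * uENorm μ f :=
  uENorm_le ((uae_le_uENorm f).mono fun ω hω => by
    rw [Pi.smul_apply, enorm_smul]; gcongr)

theorem uENorm_smul (c : ℂ) (f : (ℕ → G) → StrongDual ℂ F) :
    uENorm μ (c • f) = ‖c‖ₑ * uENorm μ f := by
  refine le_antisymm (uENorm_smul_le c f) ?_
  rcases eq_or_ne c 0 with rfl | hc
  · simp
  have h := uENorm_smul_le (μ := μ) c⁻¹ (c • f)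
  rw [smul_smul, inv_mul_cancel₀ hc, one_smul] at h
  calc ‖c‖ₑ * uENorm μ f ≤ ‖c‖ₑ * (‖c⁻¹‖ₑ * uENorm μ (c • f)) := by gcongr
    _ = uENorm μ (c • f) := by
      rw [← mul_assoc, ← enorm_mul, mul_inv_cancel₀ hc]; simp

theorem uENorm_zero : uENorm μ (0 : (ℕ → G) → StrongDual ℂ F) = 0 :=
  le_antisymm (uENorm_le (UAE.of_forall fun ω => by simp)) bot_le

variable (F) (μ)

/-- The universally essentially bounded `E`-valued invariant random variables. -/
def preLinfty : Submodule ℂ ((ℕ → G) → StrongDual ℂ F) where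
  carrier := {f | IsInvariantRV f ∧ uENorm μ f < ∞}
  add_mem' {f g} hf hg :=
    ⟨fun v => by
      let : MeasurableSpace (ℕ → G) := MeasurableSpace.invariants (shift (G := G))
      exact (hf.1 v).add (hg.1 v),
      (uENorm_add_le f g).trans_lt (ENNReal.add_lt_top.2 ⟨hf.2, hg.2⟩)⟩
  zero_mem' := ⟨fun v => by
      let : MeasurableSpace (ℕ → G) := MeasurableSpace.invariants (shift (G := G))
      exact measurable_const, by rw [uENorm_zero]; simp⟩
  smul_mem' c f hf :=
    ⟨fun v => by
      let : MeasurableSpace (ℕ → G) := MeasurableSpace.invariants (shift (G := G))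
      exact (hf.1 v).const_smul c,
      by rw [uENorm_smul]; exact ENNReal.mul_lt_top (by simp) hf.2⟩

/-- The random variables that vanish universally almost everywhere. -/
def nullRV : Submodule ℂ (preLinfty μ F) where
  carrier := {f | UAE μ fun ω => f.1 ω = 0}
  add_mem' {f g} hf hg := (UAE.and hf hg).mono fun ω hω => by
    change f.1 ω + g.1 ω = 0
    rw [hω.1, hω.2, add_zero]
  zero_mem' := UAE.of_forall fun _ => rfl
  smul_mem' c f hf := UAE.mono hf fun ω hω => by
    change c • f.1 ω = 0
    rw [hω]; exact smul_zero c

/-- `𝕃^∞_i(μ, E)`: universally essentially bounded invariant random variables modulo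
equality universally almost everywhere. -/
def Linfty : Type _ := preLinfty μ F ⧸ nullRV μ F

instance : AddCommGroup (Linfty μ F) := inferInstanceAs (AddCommGroup (preLinfty μ F ⧸ nullRV μ F))
instance : Module ℂ (Linfty μ F) := inferInstanceAs (Module ℂ (preLinfty μ F ⧸ nullRV μ F))

variable {F}

/-- The class of a random variable in `𝕃^∞_i(μ, E)`. -/
def toLinfty : preLinfty μ F →ₗ[ℂ] Linfty μ F := (nullRV μ F).mkQ

variable {μ}

theorem toLinfty_surjective : Function.Surjective (toLinfty μ (F := F)) :=
  (nullRV μ F).mkQ_surjective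

theorem toLinfty_eq_iff {f g : preLinfty μ F} :
    toLinfty μ f = toLinfty μ g ↔ UAE μ fun ω => f.1 ω = g.1 ω := by
  refine (Submodule.Quotient.eq (nullRV μ F)).trans ?_
  constructor
  · exact fun h => UAE.mono h fun ω hω => sub_eq_zero.1 hω
  · exact fun h => UAE.mono h fun ω hω => sub_eq_zero.2 hω

/-- The norm `‖·‖_u` on `𝕃^∞_i(μ, E)`. -/
instance : Norm (Linfty μ F) where
  norm x := Quotient.liftOn' x (fun f : preLinfty μ F => (uENorm μ f.1).toReal) fun f g h => by
    have h' : toLinfty μ f = toLinfty μ g := Quotient.sound' h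
    exact congrArg ENNReal.toReal (uENorm_congr (toLinfty_eq_iff.1 h'))

theorem norm_toLinfty (f : preLinfty μ F) : ‖toLinfty μ f‖ = (uENorm μ f.1).toReal := rfl

theorem linfty_core : NormedSpace.Core ℂ (Linfty μ F) where
  norm_nonneg x := by
    obtain ⟨f, rfl⟩ := toLinfty_surjective x
    rw [norm_toLinfty]; exact ENNReal.toReal_nonneg
  norm_smul c x := by
    obtain ⟨f, rfl⟩ := toLinfty_surjective x
    rw [← map_smul, norm_toLinfty, norm_toLinfty]
    change (uENorm μ (c • f.1)).toReal = _
    rw [uENorm_smul, ENNReal.toReal_mul, toReal_enorm]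
  norm_triangle x y := by
    obtain ⟨f, rfl⟩ := toLinfty_surjective x
    obtain ⟨g, rfl⟩ := toLinfty_surjective y
    rw [← map_add, norm_toLinfty, norm_toLinfty, norm_toLinfty,
      ← ENNReal.toReal_add f.2.2.ne g.2.2.ne]
    exact ENNReal.toReal_mono (ENNReal.add_lt_top.2 ⟨f.2.2, g.2.2⟩).ne (uENorm_add_le f.1 g.1)
  norm_eq_zero_iff x := by
    obtain ⟨f, rfl⟩ := toLinfty_surjective x
    rw [norm_toLinfty, ENNReal.toReal_eq_zero_iff, or_iff_left f.2.2.ne, ← map_zero (toLinfty μ),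
      toLinfty_eq_iff]
    constructor
    · intro h
      exact (uae_le_uENorm f.1).mono fun ω hω => by
        rw [h] at hω
        exact enorm_eq_zero.1 (le_antisymm hω bot_le)
    · intro h
      rw [uENorm_congr (g := 0) h, uENorm_zero]

instance : NormedAddCommGroup (Linfty μ F) := NormedAddCommGroup.ofCore linfty_core
instance : NormedSpace ℂ (Linfty μ F) := NormedSpace.ofCore linfty_core

theorem preLinfty_exists_integral (f : preLinfty μ F) (g : G) :
    ∃ y, IsWeakStarIntegral (markovMeasure μ g) f.1 y := by
  refine exists_isWeakStarIntegral _ (C := (uENorm μ f.1).toReal)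
    (fun v => (f.2.1 v).mono (MeasurableSpace.invariants_le _) le_rfl) ?_
  refine ((uae_le_uENorm f.1).ae g).mono fun ω hω => ?_
  rw [← toReal_enorm]
  exact ENNReal.toReal_mono f.2.2.ne hω

variable (μ)

/-- `(R_E f)(g) = ∫ f(ω) Q_g(dω)`, first on random variables. -/
def preRE (g : G) : preLinfty μ F →ₗ[ℂ] StrongDual ℂ F where
  toFun f := weakStarIntegral (markovMeasure μ g) f.1
  map_add' f f' := ((weakStarIntegral_spec (preLinfty_exists_integral f g)).add
    (weakStarIntegral_spec (preLinfty_exists_integral f' g))).eq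
  map_smul' c f := ((weakStarIntegral_spec (preLinfty_exists_integral f g)).smul c).eq

/-- `(R_E f)(g) = ∫ f(ω) Q_g(dω)` for `f ∈ 𝕃^∞_i(μ, E)`. -/
def RE (g : G) : Linfty μ F →ₗ[ℂ] StrongDual ℂ F :=
  (nullRV μ F).liftQ (preRE μ g) fun f hf => by
    refine LinearMap.mem_ker.2 (IsWeakStarIntegral.eq fun v => ?_)
    have h0 : (fun ω => f.1 ω v) =ᵐ[markovMeasure μ g] fun _ => (0 : ℂ) :=
      (UAE.ae hf g).mono fun ω hω => by
        change f.1 ω v = 0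
        rw [hω]; rfl
    exact ⟨(integrable_congr h0).2 (integrable_zero _ _ _), by
      rw [integral_congr_ae h0]; simp⟩

theorem RE_toLinfty (g : G) (f : preLinfty μ F) :
    RE μ g (toLinfty μ f) = weakStarIntegral (markovMeasure μ g) f.1 := rfl

end Linfty

/-! ### Harmonic vectors of a representation -/

section Representation

variable {G : Type*} [Group G] {F : Type*} [NormedAddCommGroup F] [NormedSpace ℂ F]

/-- The adjoint `π(g) = [π_*(g⁻¹)]^*` of an isometric representation `π_*` in the predual. -/
def dualRep (πs : G →* (F ≃ₗᵢ[ℂ] F)) (g : G) : StrongDual ℂ F →ₗ[ℂ] StrongDual ℂ F where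
  toFun x := x.comp ((πs g⁻¹).toContinuousLinearEquiv : F →L[ℂ] F)
  map_add' _ _ := rfl
  map_smul' _ _ := rfl

theorem dualRep_apply (πs : G →* (F ≃ₗᵢ[ℂ] F)) (g : G) (x : StrongDual ℂ F) (v : F) :
    dualRep πs g x v = x (πs g⁻¹ v) := rfl

/-- The space `H_{μπ}` of `μ`-harmonic vectors: `x = π(μ)x`, i.e. `x = ∫ π(g)x μ(dg)` in the
weak* sense. -/
def harmonicVectors [MeasurableSpace G] (μ : Measure G) (πs : G →* (F ≃ₗᵢ[ℂ] F)) :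
    Submodule ℂ (StrongDual ℂ F) where
  carrier := {x | IsWeakStarIntegral μ (fun g => dualRep πs g x) x}
  add_mem' hx hy := hx.add hy
  zero_mem' := IsWeakStarIntegral.zero
  smul_mem' c _ hx := hx.smul c

variable [TopologicalSpace G] [IsTopologicalGroup G]
  [MeasurableSpace G] [BorelSpace G] (μ : Measure G) [IsProbabilityMeasure μ] [μ.Regular]

/-- Representatives of elements of `𝕃_{μπ}`: `g⁻¹f = π̂(g)f` for every `g`, i.e.
`f(gω) = π(g)f(ω)` universally almost everywhere, where `gω = (gω₀, gω₁, …)`. -/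
def preLmuPi (πs : G →* (F ≃ₗᵢ[ℂ] F)) : Submodule ℂ (preLinfty μ F) where
  carrier := {f | ∀ g : G, UAE μ fun ω => f.1 (fun n => g * ω n) = dualRep πs g (f.1 ω)}
  add_mem' {f f'} hf hf' g := ((hf g).and (hf' g)).mono fun ω hω => by
    change f.1 _ + f'.1 _ = dualRep πs g (f.1 ω + f'.1 ω)
    rw [hω.1, hω.2, map_add]
  zero_mem' g := UAE.of_forall fun _ => rfl
  smul_mem' c f hf g := (hf g).mono fun ω hω => by
    change c • f.1 _ = dualRep πs g (c • f.1 ω)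
    rw [hω, map_smul]

/-- The subspace `𝕃_{μπ}` of `𝕃^∞_i(μ, E)`. -/
def LmuPi (πs : G →* (F ≃ₗᵢ[ℂ] F)) : Submodule ℂ (Linfty μ F) :=
  (preLmuPi μ πs).map (toLinfty μ)

end Representation

end ChoquetDeny

end

/-!
The theorem is a vector-valued Poisson formula, and rests on the Markov property of the path
measures `Q_g` together with martingale convergence. As `G` need not be second countable,
multiplication on `G × G` need not be measurable for the product `σ`-algebra; only one-variable maps
and the coefficients `g ↦ ⟨v, π(g)x⟩`, which are continuous, are ever integrated.

*The path measures.* `Q_g` is characterized by its initial law and its one-step transitions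
(`eq_markovMeasure`). Hence, given the history up to time `n`, the path from time `n` on, translated
by `g`, has law `Q_{gωₙ}` (`traj_map_mul_shift`): this contains the Markov property and the
equivariance `gQ_h = Q_{gh}`.

*From random variables to vectors.* Let `f ∈ 𝕃_{μπ}` and `x = ∫ f dQ_e`. Equivariance gives
`⟨v, π(g)x⟩ = ∫ ⟨v, f⟩ dQ_g` (`dualRep_integral_apply`), and the Markov property at time `1` then
shows that `x` is harmonic. The Markov property at time `n` identifies `⟨v, π(ωₙ)x⟩` with the
conditional expectation of `⟨v, f⟩` given `(ω₀, …, ωₙ)`, so by Lévy's upward theorem it converges to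
`⟨v, f(ω)⟩`, `Q_g`-a.e. for every `g`. The convergence set is shift-invariant, and as the predual is
separable and the vectors `π(ωₙ)x` are bounded by `‖x‖`, countably many `v` suffice
(`uae_tendsto_dualRep`). So `f` is recovered from `x`, and `‖f‖_u ≤ ‖x‖`; the reverse inequality is
the triangle inequality for integrals (`norm_toLinfty_eq`).

*From vectors to random variables.* If `x` is harmonic, `⟨v, π(ωₙ)x⟩` is a bounded martingale, hence
converges a.e. The weak* limit of `π(ωₙ)x` (`boundaryValue`) is an invariant, equivariant, bounded
random variable, and by dominated convergence its integral is `x` (`exists_preLmuPi_integral`).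
-/

namespace ChoquetDeny

open Preorder

/-! ### The Markov property of the path measures -/

theorem shift_invariant_iterate {G : Type*} {α : Type*} {φ : (ℕ → G) → α}
    (hφ : ∀ ω, φ (shift ω) = φ ω) (n : ℕ) (ω : ℕ → G) : φ (fun k => ω (n + k)) = φ ω := by
  induction n with
  | zero => simp
  | succ n ih =>
    rw [← ih, ← hφ (fun k => ω (n + k))]
    congr 1
    funext k
    change ω (n + 1 + k) = ω (n + (k + 1))
    congr 1
    ring

theorem iSup_piLE {G : Type*} [MeasurableSpace G] :
    (⨆ n : ℕ, (Filtration.piLE (X := fun _ : ℕ => G) n)) = MeasurableSpace.pi := by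
  refine le_antisymm (iSup_le fun n => Filtration.le _ n) (iSup_le fun n => ?_)
  refine le_trans ?_ (le_iSup _ n)
  rw [Filtration.piLE_eq_comap_frestrictLe, ← measurable_iff_comap_le]
  have : (fun ω : ℕ → G => ω n) =
      (fun p : Finset.Iic n → G => p ⟨n, Finset.mem_Iic.2 le_rfl⟩) ∘ frestrictLe n := rfl
  rw [this]
  exact (measurable_pi_apply _).comp (comap_measurable _)

section PathMeasure

variable {G : Type*} [Group G] [TopologicalSpace G] [IsTopologicalGroup G]
  [MeasurableSpace G] [BorelSpace G] {μ : Measure G} [IsProbabilityMeasure μ] [μ.Regular]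

/-- The Markov measure `Q_g` is determined by its initial law `δ_g` and by the conditional law of
`ω_{b+1}` given `(ω₀, …, ω_b)`. -/
theorem eq_markovMeasure {ν : Measure (ℕ → G)} {g : G}
    (h0 : ν.map (fun ω => ω 0) = Measure.dirac g)
    (hs : ∀ b, ν.map (fun ω => (frestrictLe (π := fun _ => G) b ω, ω (b + 1))) =
      (ν.map (frestrictLe b)) ⊗ₘ historyKernel μ b) :
    ν = markovMeasure μ g := by
  have key : ∀ n, ν.map (frestrictLe n) =
      Kernel.partialTraj (X := fun _ => G) (historyKernel μ) 0 n (fun _ => g) := by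
    intro n
    induction n with
    | zero =>
      have h1 : (frestrictLe 0 : (ℕ → G) → _) =
          (fun (y : G) (_ : Finset.Iic 0) => y) ∘ fun ω : ℕ → G => ω 0 := by
        funext ω i
        obtain ⟨i, hi⟩ := i
        obtain rfl : i = 0 := by simpa using hi
        rfl
      rw [h1, ← Measure.map_map (by fun_prop) (by fun_prop), h0,
        Measure.map_dirac' (by fun_prop), Kernel.partialTraj_self, Kernel.id_apply]
    | succ b ih =>
      -- `M` glues a history up to time `b` and a next position to a history up to time `b + 1`.
      let M : (Finset.Iic b → G) × G → (Finset.Iic (b + 1) → G) := fun p i =>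
        if h : (i : ℕ) ≤ b then p.1 ⟨i, Finset.mem_Iic.2 h⟩ else p.2
      have hM : Measurable M := by
        refine measurable_pi_lambda _ fun i => ?_
        by_cases h : (i : ℕ) ≤ b
        · simp only [M, h, dif_pos]; fun_prop
        · simp only [M, h, dif_neg, not_false_iff]; fun_prop
      have h1 : (frestrictLe (b + 1) : (ℕ → G) → _) =
          M ∘ fun ω : ℕ → G => (frestrictLe (π := fun _ => G) b ω, ω (b + 1)) := by
        funext ω i
        obtain ⟨i, hi⟩ := i
        have hi' : i ≤ b + 1 := by simpa using hi
        by_cases h : i ≤ b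
        · simp [M, h]
        · obtain rfl : i = b + 1 := by omega
          simp [M]
      rw [← Kernel.traj_map_frestrictLe_apply, h1, ← Measure.map_map hM (by fun_prop),
        ← Measure.map_map hM (by fun_prop), hs, ih,
        ← Kernel.partialTraj_compProd_eq_map_traj (Nat.zero_le b)]
  let P := inducedFamily (X := fun _ => G) (fun n =>
    Kernel.partialTraj (X := fun _ => G) (historyKernel μ) 0 n (fun _ => g))
  have hlim : IsProjectiveLimit (markovMeasure μ g) P :=
    Kernel.isProjectiveLimit_trajFun (X := fun _ => G) (historyKernel μ) 0 (fun _ => g)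
  have hfin : ∀ I : Finset ℕ, IsFiniteMeasure (P I) := fun I => by
    unfold P inducedFamily
    exact Measure.isFiniteMeasure_map _ _
  refine IsProjectiveLimit.unique (P := P) ?_ hlim
  rw [isProjectiveLimit_nat_iff (Kernel.isProjectiveMeasureFamily_partialTraj _ _)]
  intro n
  rw [inducedFamily_Iic]
  exact key n

/-- Transport of a composition-product along a pair of maps that intertwine the two kernels. -/
theorem map_prodMap_compProd {α α' β β' : Type*} [MeasurableSpace α] [MeasurableSpace α']
    [MeasurableSpace β] [MeasurableSpace β'] {m : Measure α} [SFinite m] {κ : Kernel α β}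
    [IsSFiniteKernel κ] {κ' : Kernel α' β'} [IsSFiniteKernel κ'] {P : α → α'} {q : β → β'}
    (hP : Measurable P) (hq : Measurable q) (h : ∀ a, (κ a).map q = κ' (P a)) :
    (m ⊗ₘ κ).map (Prod.map P q) = (m.map P) ⊗ₘ κ' := by
  ext s hs
  rw [Measure.map_apply (hP.prodMap hq) hs, Measure.compProd_apply ((hP.prodMap hq) hs),
    Measure.compProd_apply hs, lintegral_map (Kernel.measurable_kernel_prodMk_left hs) hP]
  refine lintegral_congr fun a => ?_
  rw [← h, Measure.map_apply hq (measurable_prodMk_left hs)]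
  rfl

/-- The kernels of the chain are invariant under left translations and homogeneous in time. -/
theorem historyKernel_map_mul (g : G) (n b : ℕ) (p : Finset.Iic (n + b) → G) :
    (historyKernel μ (n + b) p).map (fun y => g * y) =
      historyKernel μ b (fun i => g * p ⟨n + i, Finset.mem_Iic.2
        (Nat.add_le_add_left (Finset.mem_Iic.1 i.2) n)⟩) := by
  change (μ.map (fun x => _ * x)).map _ = μ.map (fun x => _ * x)
  rw [Measure.map_map (measurable_const_mul _) (measurable_const_mul _)]
  congr 1
  funext y
  exact (mul_assoc _ _ _).symm

/-- Conditionally on the history up to time `n`, the translate by `g` of the trajectory from time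
`n` on is the random walk started at `g ωₙ`. For `g = 1` this is the Markov property, for `n = 0`
it is the equivariance of `g ↦ Q_g` under left translations. -/
theorem traj_map_mul_shift (g : G) (n : ℕ) (p : Finset.Iic n → G) :
    (Kernel.traj (X := fun _ => G) (historyKernel μ) n p).map (fun ω k => g * ω (n + k)) =
      markovMeasure μ (g * p ⟨n, Finset.mem_Iic.2 le_rfl⟩) := by
  have hmul : Measurable fun y : G => g * y := measurable_const_mul g
  have hT : Measurable fun (ω : ℕ → G) (k : ℕ) => g * ω (n + k) :=
    measurable_pi_lambda _ fun k => hmul.comp (measurable_pi_apply _)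
  refine eq_markovMeasure ?_ fun b => ?_
  · rw [Measure.map_map (by fun_prop) hT]
    have h1 : ((fun ω : ℕ → G => ω 0) ∘ fun (ω : ℕ → G) (k : ℕ) => g * ω (n + k)) =
        (fun q : Finset.Iic n → G => g * q ⟨n, Finset.mem_Iic.2 le_rfl⟩) ∘ frestrictLe n := rfl
    have h2 : Measurable fun q : Finset.Iic n → G => g * q ⟨n, Finset.mem_Iic.2 le_rfl⟩ :=
      hmul.comp (measurable_pi_apply _)
    rw [h1, ← Measure.map_map h2 (measurable_frestrictLe n), Kernel.traj_map_frestrictLe_apply,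
      Kernel.partialTraj_self, Kernel.id_apply, Measure.map_dirac' h2]
  · let P : (Finset.Iic (n + b) → G) → (Finset.Iic b → G) := fun q i =>
      g * q ⟨n + i, Finset.mem_Iic.2 (Nat.add_le_add_left (Finset.mem_Iic.1 i.2) n)⟩
    have hP : Measurable P := measurable_pi_lambda _ fun i => hmul.comp (measurable_pi_apply _)
    have h1 : ((fun ω : ℕ → G => (frestrictLe (π := fun _ => G) b ω, ω (b + 1))) ∘
        fun (ω : ℕ → G) (k : ℕ) => g * ω (n + k)) =
        Prod.map P (fun y => g * y) ∘
          fun ω : ℕ → G => (frestrictLe (π := fun _ => G) (n + b) ω, ω (n + b + 1)) := rfl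
    have h2 : (frestrictLe b : (ℕ → G) → _) ∘ (fun (ω : ℕ → G) (k : ℕ) => g * ω (n + k)) =
        P ∘ frestrictLe (n + b) := rfl
    rw [Measure.map_map (by fun_prop) hT, Measure.map_map (measurable_frestrictLe b) hT, h1, h2,
      ← Measure.map_map (hP.prodMap hmul) (by fun_prop),
      ← Measure.map_map hP (measurable_frestrictLe _),
      ← Kernel.partialTraj_compProd_eq_map_traj (Nat.le_add_right n b),
      Kernel.traj_map_frestrictLe_apply]
    exact map_prodMap_compProd hP hmul fun q => historyKernel_map_mul g n b q

theorem markovMeasure_map_mul (g h : G) :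
    (markovMeasure μ h).map (fun ω n => g * ω n) = markovMeasure μ (g * h) := by
  have := traj_map_mul_shift (μ := μ) g 0 (fun _ => h)
  simp only [zero_add] at this
  exact this

/-- The Markov property at time `n`. -/
theorem traj_map_shift (n : ℕ) (p : Finset.Iic n → G) :
    (Kernel.traj (X := fun _ => G) (historyKernel μ) n p).map (fun ω k => ω (n + k)) =
      markovMeasure μ (p ⟨n, Finset.mem_Iic.2 le_rfl⟩) := by
  simpa using traj_map_mul_shift (μ := μ) 1 n p

/-! ### Invariant random variables and bounded harmonic functions -/

variable {E : Type*} [NormedAddCommGroup E] [NormedSpace ℝ E]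

/-- Given the history up to time `n`, the expectation of an invariant random variable depends only
on the last position `ωₙ`. -/
theorem integral_traj_of_invariant {φ : (ℕ → G) → E} (hm : StronglyMeasurable φ)
    (hφ : ∀ ω, φ (shift ω) = φ ω) (n : ℕ) (p : Finset.Iic n → G) :
    ∫ ω, φ ω ∂(Kernel.traj (X := fun _ => G) (historyKernel μ) n p) =
      ∫ ω, φ ω ∂(markovMeasure μ (p ⟨n, Finset.mem_Iic.2 le_rfl⟩)) := by
  have hT : Measurable fun (ω : ℕ → G) (k : ℕ) => ω (n + k) :=
    measurable_pi_lambda _ fun k => measurable_pi_apply _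
  rw [← traj_map_shift, integral_map hT.aemeasurable hm.aestronglyMeasurable]
  simp_rw [shift_invariant_iterate hφ]

/-- The transition kernel at time `0`, as the law of `ω₁`. -/
theorem integral_partialTraj_one {h : G → E} (hm : StronglyMeasurable h) (g : G) :
    ∫ p, h (p ⟨1, Finset.mem_Iic.2 le_rfl⟩) ∂(Kernel.partialTraj (X := fun _ => G)
      (historyKernel μ) 0 1 (fun _ => g)) = ∫ y, h (g * y) ∂μ := by
  rw [← integral_map (φ := fun p : Finset.Iic 1 → G => p ⟨1, Finset.mem_Iic.2 le_rfl⟩)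
    (measurable_pi_apply _).aemeasurable hm.aestronglyMeasurable,
    ← Kernel.map_apply _ (measurable_pi_apply _)]
  have := Kernel.map_partialTraj_succ_self (X := fun _ => G) (κ := historyKernel μ) 0
  rw [zero_add] at this
  rw [this]
  change ∫ y, h y ∂(μ.map (fun x => g * x)) = _
  rw [integral_map (measurable_const_mul g).aemeasurable hm.aestronglyMeasurable]

/-- The Poisson integral `g ↦ ∫ φ dQ_g` of an invariant random variable is harmonic. -/
theorem integral_invariant_harmonic {φ : (ℕ → G) → E} (hm : StronglyMeasurable φ)
    (hφ : ∀ ω, φ (shift ω) = φ ω) (hi : ∀ g, Integrable φ (markovMeasure μ g))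
    (hh : StronglyMeasurable fun g => ∫ ω, φ ω ∂(markovMeasure μ g)) (g : G) :
    ∫ y, (∫ ω, φ ω ∂(markovMeasure μ (g * y))) ∂μ = ∫ ω, φ ω ∂(markovMeasure μ g) := by
  rw [← integral_partialTraj_one hh]
  have := Kernel.integral_traj_partialTraj (X := fun _ => G) (κ := historyKernel μ)
    (Nat.zero_le 1) (x₀ := fun _ => g) (hi g)
  simp_rw [integral_traj_of_invariant hm hφ] at this
  exact this

/-- By Lévy's upward theorem and the Markov property, an invariant random variable is the limit of
its Poisson integral along the trajectory. -/
theorem ae_tendsto_integral_real {φ : (ℕ → G) → ℝ} (hm : Measurable φ)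
    (hφ : ∀ ω, φ (shift ω) = φ ω) {g : G} (hi : Integrable φ (markovMeasure μ g)) :
    ∀ᵐ ω ∂(markovMeasure μ g),
      Tendsto (fun n => ∫ ω', φ ω' ∂(markovMeasure μ (ω n))) atTop (𝓝 (φ ω)) := by
  have h1 := hi.tendsto_ae_condExp (ℱ := Filtration.piLE)
    (by rw [iSup_piLE]; exact hm.stronglyMeasurable)
  have h2 : ∀ n, (markovMeasure μ g)[φ | (Filtration.piLE n)] =ᵐ[markovMeasure μ g]
      fun ω => ∫ ω', φ ω' ∂(markovMeasure μ (ω n)) := fun n => by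
    refine (Kernel.condExp_traj (Nat.zero_le n) hi).trans (.of_forall fun ω => ?_)
    exact integral_traj_of_invariant hm.stronglyMeasurable hφ n _
  filter_upwards [h1, ae_all_iff.2 h2] with ω h1 h2
  simpa only [h2] using h1

theorem ae_tendsto_integral {φ : (ℕ → G) → ℂ} (hm : Measurable φ)
    (hφ : ∀ ω, φ (shift ω) = φ ω) (hi : ∀ g, Integrable φ (markovMeasure μ g)) (g : G) :
    ∀ᵐ ω ∂(markovMeasure μ g),
      Tendsto (fun n => ∫ ω', φ ω' ∂(markovMeasure μ (ω n))) atTop (𝓝 (φ ω)) := by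
  filter_upwards [ae_tendsto_integral_real (Complex.measurable_re.comp hm)
      (fun ω => congrArg Complex.re (hφ ω)) (hi g).re,
    ae_tendsto_integral_real (Complex.measurable_im.comp hm)
      (fun ω => congrArg Complex.im (hφ ω)) (hi g).im] with ω hre him
  have h1 : ∀ g, ∫ ω', (Complex.re ∘ φ) ω' ∂(markovMeasure μ g) =
      (∫ ω', φ ω' ∂(markovMeasure μ g)).re := fun g => integral_re (hi g)
  have h2 : ∀ g, ∫ ω', (Complex.im ∘ φ) ω' ∂(markovMeasure μ g) =
      (∫ ω', φ ω' ∂(markovMeasure μ g)).im := fun g => integral_im (hi g)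
  simp only [h1, h2] at hre him
  have := ((Complex.continuous_ofReal.tendsto _).comp hre).add
    (((Complex.continuous_ofReal.tendsto _).comp him).mul_const Complex.I)
  simpa [Function.comp_def] using this

/-- Along the trajectories, a bounded harmonic function is a martingale. -/
theorem martingale_harmonic [CompleteSpace E] {h : G → E} (hm : StronglyMeasurable h) {C : ℝ}
    (hC : ∀ g, ‖h g‖ ≤ C) (hh : ∀ g, h g = ∫ y, h (g * y) ∂μ) (g : G) :
    Martingale (fun n (ω : ℕ → G) => h (ω n)) Filtration.piLE (markovMeasure μ g) := by
  have hmn : ∀ n, StronglyMeasurable fun ω : ℕ → G => h (ω n) := fun n =>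
    hm.comp_measurable (measurable_pi_apply n)
  have hint : ∀ n, Integrable (fun ω : ℕ → G => h (ω n)) (markovMeasure μ g) := fun n =>
    Integrable.of_bound (hmn n).aestronglyMeasurable C (.of_forall fun ω => hC _)
  refine martingale_nat (fun n => ?_) hint fun n => ?_
  · rw [Filtration.piLE_eq_comap_frestrictLe]
    have hp : Measurable fun p : Finset.Iic n → G => p ⟨n, Finset.mem_Iic.2 le_rfl⟩ :=
      measurable_pi_apply _
    exact (hm.comp_measurable hp).comp_measurable
      (g := frestrictLe (π := fun _ => G) n) (comap_measurable _)
  · refine .trans (.of_forall fun ω => ?_) (Kernel.condExp_traj (Nat.zero_le n) (hint (n + 1))).symm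
    change h (ω n) = ∫ y, h (y (n + 1)) ∂(Kernel.traj (X := fun _ => G) (historyKernel μ) n
      (frestrictLe n ω))
    rw [← integral_map (φ := fun y : ℕ → G => y (n + 1))
      (measurable_pi_apply _).aemeasurable hm.aestronglyMeasurable,
      ← Kernel.map_apply _ (measurable_pi_apply _), Kernel.map_traj_succ_self]
    change _ = ∫ y, h y ∂(μ.map (fun x => ω n * x))
    rw [integral_map (measurable_const_mul _).aemeasurable hm.aestronglyMeasurable]
    exact hh _

/-- The mean value of a bounded harmonic function along the random walk is constant in time. -/
theorem integral_harmonic [CompleteSpace E] {h : G → E} (hm : StronglyMeasurable h) {C : ℝ}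
    (hC : ∀ g, ‖h g‖ ≤ C) (hh : ∀ g, h g = ∫ y, h (g * y) ∂μ) (g : G) (n : ℕ) :
    ∫ ω, h (ω n) ∂(markovMeasure μ g) = h g := by
  have h1 := (martingale_harmonic hm hC hh g).setIntegral_eq (Nat.zero_le n) MeasurableSet.univ
  simp only [Measure.restrict_univ] at h1
  rw [← h1]
  -- The walk starts at `g`: the law of the history up to time `0` is a Dirac mass.
  have h2 : (markovMeasure μ g).map (frestrictLe 0) = Measure.dirac (fun _ => g) := by
    unfold markovMeasure
    rw [Kernel.traj_map_frestrictLe_apply, Kernel.partialTraj_self, Kernel.id_apply]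
  have h3 := congrArg (fun m => ∫ p, h (p ⟨0, Finset.mem_Iic.2 le_rfl⟩) ∂m) h2
  have hm' : StronglyMeasurable fun p : Finset.Iic 0 → G => h (p ⟨0, Finset.mem_Iic.2 le_rfl⟩) :=
    hm.comp_measurable (measurable_pi_apply _)
  rw [integral_map (measurable_frestrictLe 0).aemeasurable hm'.aestronglyMeasurable,
    integral_dirac' _ _ hm'] at h3
  exact h3

theorem ae_exists_tendsto_real {h : G → ℝ} (hm : Measurable h) {C : ℝ}
    (hC : ∀ g, ‖h g‖ ≤ C) (hh : ∀ g, h g = ∫ y, h (g * y) ∂μ) (g : G) :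
    ∀ᵐ ω ∂(markovMeasure μ g), ∃ c, Tendsto (fun n => h (ω n)) atTop (𝓝 c) := by
  have hb : ∀ n, eLpNorm (fun ω : ℕ → G => h (ω n)) 1 (markovMeasure μ g) ≤
      C.toNNReal := fun n => by
    have hb' : ∀ᵐ ω ∂(markovMeasure μ g), ‖h (ω n)‖ ≤ C := .of_forall fun ω => hC (ω n)
    have := eLpNorm_le_of_ae_bound (p := 1) hb'
    rwa [measure_univ, ENNReal.one_rpow, one_mul] at this
  exact (martingale_harmonic hm.stronglyMeasurable hC hh g).submartingale.exists_ae_tendsto_of_bdd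
    hb

/-- By the martingale convergence theorem, bounded harmonic functions converge along almost every
trajectory. -/
theorem ae_exists_tendsto {h : G → ℂ} (hm : Measurable h) {C : ℝ}
    (hC : ∀ g, ‖h g‖ ≤ C) (hh : ∀ g, h g = ∫ y, h (g * y) ∂μ) (g : G) :
    ∀ᵐ ω ∂(markovMeasure μ g), ∃ c, Tendsto (fun n => h (ω n)) atTop (𝓝 c) := by
  have hi : ∀ g, Integrable (fun y => h (g * y)) μ := fun g =>
    Integrable.of_bound (hm.comp (measurable_const_mul g)).aestronglyMeasurable C
      (.of_forall fun y => hC _)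
  have hre : ∀ g, (h g).re = ∫ y, (h (g * y)).re ∂μ := fun g =>
    (congrArg Complex.re (hh g)).trans (integral_re (hi g)).symm
  have him : ∀ g, (h g).im = ∫ y, (h (g * y)).im ∂μ := fun g =>
    (congrArg Complex.im (hh g)).trans (integral_im (hi g)).symm
  filter_upwards [ae_exists_tendsto_real (Complex.measurable_re.comp hm)
      (fun g => (Complex.abs_re_le_norm _).trans (hC g)) hre g,
    ae_exists_tendsto_real (Complex.measurable_im.comp hm)
      (fun g => (Complex.abs_im_le_norm _).trans (hC g)) him g] with ω ⟨a, ha⟩ ⟨b, hb⟩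
  refine ⟨a + b * Complex.I, ?_⟩
  have := ((Complex.continuous_ofReal.tendsto _).comp ha).add
    (((Complex.continuous_ofReal.tendsto _).comp hb).mul_const Complex.I)
  simpa [Function.comp_def] using this

end PathMeasure

/-! ### Weak* limits of bounded sequences -/

section WeakStarLimit

variable {F : Type*} [NormedAddCommGroup F] [NormedSpace ℂ F]

/-- A bounded sequence of functionals that converges pointwise on a dense sequence converges
weak*. -/
theorem exists_weakStar_limit {y : ℕ → StrongDual ℂ F} {C : ℝ} (hb : ∀ n, ‖y n‖ ≤ C) {d : ℕ → F}
    (hd : DenseRange d) (hc : ∀ k, ∃ c, Tendsto (fun n => y n (d k)) atTop (𝓝 c)) :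
    ∃ z : StrongDual ℂ F, ∀ v, Tendsto (fun n => y n v) atTop (𝓝 (z v)) := by
  have hC : 0 ≤ C := (norm_nonneg _).trans (hb 0)
  have hy : ∀ n v, ‖y n v‖ ≤ C * ‖v‖ := fun n v =>
    ((y n).le_opNorm v).trans (mul_le_mul_of_nonneg_right (hb n) (norm_nonneg v))
  have hlim : ∀ v, ∃ c, Tendsto (fun n => y n v) atTop (𝓝 c) := by
    intro v
    refine cauchySeq_tendsto_of_complete (Metric.cauchySeq_iff'.2 fun ε hε => ?_)
    obtain ⟨k, hk⟩ := hd.exists_dist_lt v (ε := ε / (3 * (C + 1))) (by positivity)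
    have hk' : C * ‖v - d k‖ < ε / 3 := by
      rw [dist_eq_norm, lt_div_iff₀ (by positivity)] at hk
      nlinarith [norm_nonneg (v - d k)]
    obtain ⟨c, hc⟩ := hc k
    obtain ⟨N, hN⟩ := Metric.cauchySeq_iff'.1 hc.cauchySeq (ε / 3) (by positivity)
    refine ⟨N, fun n hn => ?_⟩
    have h1 := hN n hn
    rw [dist_eq_norm] at h1 ⊢
    have h2 : y n v - y N v = y n (v - d k) + (y n (d k) - y N (d k)) - y N (v - d k) := by
      simp only [map_sub]; ring
    rw [h2]
    refine (norm_sub_le _ _).trans_lt ?_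
    have := norm_add_le (y n (v - d k)) (y n (d k) - y N (d k))
    linarith [hy n (v - d k), hy N (v - d k)]
  choose z hz using hlim
  let L : F →ₗ[ℂ] ℂ := linearMapOfTendsto z (fun n => (y n : F →ₗ[ℂ] ℂ)) (tendsto_pi_nhds.2 hz)
  exact ⟨L.mkContinuous C fun v => le_of_tendsto (hz v).norm (.of_forall fun n => hy n v), hz⟩

theorem tendsto_of_tendsto_denseRange {y : ℕ → StrongDual ℂ F} {C : ℝ} (hb : ∀ n, ‖y n‖ ≤ C)
    {d : ℕ → F} (hd : DenseRange d) {z : StrongDual ℂ F}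
    (hc : ∀ k, Tendsto (fun n => y n (d k)) atTop (𝓝 (z (d k)))) (v : F) :
    Tendsto (fun n => y n v) atTop (𝓝 (z v)) := by
  obtain ⟨z', hz'⟩ := exists_weakStar_limit hb hd fun k => ⟨_, hc k⟩
  have : ⇑z' = z := hd.equalizer z'.continuous z.continuous
    (funext fun k => tendsto_nhds_unique (hz' _) (hc k))
  rw [← this]
  exact hz' v

theorem norm_le_of_weakStar_tendsto {y : ℕ → StrongDual ℂ F} {C : ℝ} (hb : ∀ n, ‖y n‖ ≤ C)
    {z : StrongDual ℂ F} (hz : ∀ v, Tendsto (fun n => y n v) atTop (𝓝 (z v))) : ‖z‖ ≤ C :=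
  z.opNorm_le_bound ((norm_nonneg _).trans (hb 0)) fun v =>
    le_of_tendsto (hz v).norm (.of_forall fun n =>
      ((y n).le_opNorm v).trans (mul_le_mul_of_nonneg_right (hb n) (norm_nonneg v)))

end WeakStarLimit

/-! ### The Poisson formula for harmonic vectors -/

section PoissonFormula

variable {G : Type*} [Group G] {F : Type*} [NormedAddCommGroup F] [NormedSpace ℂ F]

theorem norm_dualRep_le (πs : G →* (F ≃ₗᵢ[ℂ] F)) (g : G) (x : StrongDual ℂ F) :
    ‖dualRep πs g x‖ ≤ ‖x‖ :=
  (dualRep πs g x).opNorm_le_bound (norm_nonneg x) fun v => by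
    rw [dualRep_apply]
    exact (x.le_opNorm _).trans_eq (by rw [LinearIsometryEquiv.norm_map])

theorem dualRep_mul_apply (πs : G →* (F ≃ₗᵢ[ℂ] F)) (g h : G) (x : StrongDual ℂ F) (v : F) :
    dualRep πs (g * h) x v = dualRep πs h x (πs g⁻¹ v) := by
  rw [dualRep_apply, dualRep_apply, mul_inv_rev, map_mul]
  rfl

/-- The coefficients of a harmonic vector are harmonic functions on `G`. -/
theorem harmonicVectors_apply [MeasurableSpace G] {μ : Measure G} {πs : G →* (F ≃ₗᵢ[ℂ] F)}
    {x : StrongDual ℂ F} (hx : x ∈ harmonicVectors μ πs) (g : G) (v : F) :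
    dualRep πs g x v = ∫ y, dualRep πs (g * y) x v ∂μ := by
  simp only [dualRep_mul_apply]
  exact (hx (πs g⁻¹ v)).2

/-- The trajectories along which `π(ωₙ)x` converges weak*. -/
def convergenceSet (πs : G →* (F ≃ₗᵢ[ℂ] F)) (x : StrongDual ℂ F) : Set (ℕ → G) :=
  {ω | ∃ z : StrongDual ℂ F, ∀ v, Tendsto (fun n => dualRep πs (ω n) x v) atTop (𝓝 (z v))}

open Classical in
/-- The boundary value `lim π(ωₙ)x` of `x`, set to `0` off the convergence set. -/
noncomputable def boundaryValue (πs : G →* (F ≃ₗᵢ[ℂ] F)) (x : StrongDual ℂ F) (ω : ℕ → G) :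
    StrongDual ℂ F :=
  if h : ω ∈ convergenceSet πs x then h.choose else 0

theorem boundaryValue_spec {πs : G →* (F ≃ₗᵢ[ℂ] F)} {x : StrongDual ℂ F} {ω : ℕ → G}
    (h : ω ∈ convergenceSet πs x) (v : F) :
    Tendsto (fun n => dualRep πs (ω n) x v) atTop (𝓝 (boundaryValue πs x ω v)) := by
  unfold boundaryValue
  rw [dif_pos h]
  exact h.choose_spec v

theorem boundaryValue_of_notMem {πs : G →* (F ≃ₗᵢ[ℂ] F)} {x : StrongDual ℂ F} {ω : ℕ → G}
    (h : ω ∉ convergenceSet πs x) : boundaryValue πs x ω = 0 := dif_neg h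

theorem boundaryValue_eq {πs : G →* (F ≃ₗᵢ[ℂ] F)} {x z : StrongDual ℂ F} {ω : ℕ → G}
    (h : ∀ v, Tendsto (fun n => dualRep πs (ω n) x v) atTop (𝓝 (z v))) :
    boundaryValue πs x ω = z :=
  ContinuousLinearMap.ext fun v =>
    tendsto_nhds_unique (boundaryValue_spec (ω := ω) ⟨z, h⟩ v) (h v)

theorem norm_boundaryValue_le (πs : G →* (F ≃ₗᵢ[ℂ] F)) (x : StrongDual ℂ F) (ω : ℕ → G) :
    ‖boundaryValue πs x ω‖ ≤ ‖x‖ := by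
  by_cases h : ω ∈ convergenceSet πs x
  · exact norm_le_of_weakStar_tendsto (fun n => norm_dualRep_le πs (ω n) x) (boundaryValue_spec h)
  · rw [boundaryValue_of_notMem h]; simp

theorem shift_mem_convergenceSet {πs : G →* (F ≃ₗᵢ[ℂ] F)} {x : StrongDual ℂ F} {ω : ℕ → G} :
    shift ω ∈ convergenceSet πs x ↔ ω ∈ convergenceSet πs x :=
  exists_congr fun _ => forall_congr' fun v =>
    tendsto_add_atTop_iff_nat (f := fun n => dualRep πs (ω n) x v) 1

theorem boundaryValue_shift (πs : G →* (F ≃ₗᵢ[ℂ] F)) (x : StrongDual ℂ F) (ω : ℕ → G) :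
    boundaryValue πs x (shift ω) = boundaryValue πs x ω := by
  by_cases h : ω ∈ convergenceSet πs x
  · exact boundaryValue_eq fun v =>
      (tendsto_add_atTop_iff_nat (f := fun n => dualRep πs (ω n) x v) 1).2 (boundaryValue_spec h v)
  · rw [boundaryValue_of_notMem h, boundaryValue_of_notMem (mt shift_mem_convergenceSet.1 h)]

theorem boundaryValue_mul {πs : G →* (F ≃ₗᵢ[ℂ] F)} {x : StrongDual ℂ F} {ω : ℕ → G}
    (h : ω ∈ convergenceSet πs x) (g : G) :
    boundaryValue πs x (fun n => g * ω n) = dualRep πs g (boundaryValue πs x ω) :=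
  boundaryValue_eq fun v => by
    simp only [dualRep_mul_apply]
    exact boundaryValue_spec h (πs g⁻¹ v)

/-- Convergence need only be tested on a dense sequence, so it is a countable condition. -/
theorem convergenceSet_eq [TopologicalSpace.SeparableSpace F] (πs : G →* (F ≃ₗᵢ[ℂ] F))
    (x : StrongDual ℂ F) : convergenceSet πs x = ⋂ k, {ω : ℕ → G | ∃ c, Tendsto
      (fun n => dualRep πs (ω n) x (TopologicalSpace.denseSeq F k)) atTop (𝓝 c)} := by
  ext ω
  rw [mem_iInter]
  exact ⟨fun ⟨_, hz⟩ k => ⟨_, hz _⟩, fun h =>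
    exists_weakStar_limit (fun n => norm_dualRep_le πs (ω n) x)
      (TopologicalSpace.denseRange_denseSeq F) h⟩

theorem measurable_invariants_of_comp_shift {G α : Type*} [MeasurableSpace G] [MeasurableSpace α]
    {φ : (ℕ → G) → α} (hm : Measurable φ) (h : ∀ ω, φ (shift ω) = φ ω) :
    Measurable[MeasurableSpace.invariants (shift (G := G))] φ :=
  MeasurableSpace.measurable_invariants_dom.2 ⟨hm, fun s _ => by
    rw [show φ ∘ shift = φ from funext h]⟩

variable [TopologicalSpace G] [IsTopologicalGroup G]

theorem continuous_dualRep_apply {πs : G →* (F ≃ₗᵢ[ℂ] F)}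
    (hπs : ∀ v : F, Continuous fun g => πs g v) (x : StrongDual ℂ F) (v : F) :
    Continuous fun g => dualRep πs g x v :=
  x.continuous.comp ((hπs v).comp continuous_inv)

variable [MeasurableSpace G] [BorelSpace G] {μ : Measure G} [IsProbabilityMeasure μ] [μ.Regular]

theorem preLinfty_measurable (f : preLinfty μ F) (v : F) : Measurable fun ω => f.1 ω v :=
  (f.2.1 v).mono (MeasurableSpace.invariants_le _) le_rfl

theorem preLinfty_shift (f : preLinfty μ F) (v : F) (ω : ℕ → G) : f.1 (shift ω) v = f.1 ω v :=
  congrFun (MeasurableSpace.comp_eq_of_measurable_invariants (f.2.1 v)) ω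

theorem UnivConull.of_ae {A : Set (ℕ → G)} (hm : MeasurableSet A) (hinv : shift ⁻¹' A = A)
    (h : ∀ g, ∀ᵐ ω ∂(markovMeasure μ g), ω ∈ A) : UnivConull μ A :=
  ⟨⟨hm, hinv⟩, fun g => (mem_ae_iff_prob_eq_one hm).1 (h g)⟩

theorem UAE.all {p : ℕ → (ℕ → G) → Prop} (h : ∀ k, UAE μ (p k)) : UAE μ fun ω => ∀ k, p k ω := by
  simp only [uae_iff_null] at *
  choose A hA h using h
  exact ⟨⋃ k, A k, UnivNull.iUnion hA, fun ω hω k =>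
    h k ω fun hk => hω (mem_iUnion.2 ⟨k, hk⟩)⟩

/-- The translate by `π(g)` of `∫ f dQ_e` is `∫ f dQ_g`, by equivariance of `f` and of the
measures `Q_g`. -/
theorem dualRep_integral_apply {πs : G →* (F ≃ₗᵢ[ℂ] F)} {f : preLinfty μ F}
    (hf : f ∈ preLmuPi μ πs) {x : StrongDual ℂ F}
    (hx : IsWeakStarIntegral (markovMeasure μ 1) f.1 x) (g : G) (v : F) :
    dualRep πs g x v = ∫ ω, f.1 ω v ∂(markovMeasure μ g) := by
  have hT : Measurable fun (ω : ℕ → G) (n : ℕ) => g * ω n :=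
    measurable_pi_lambda _ fun k => (measurable_const_mul g).comp (measurable_pi_apply _)
  have h1 := markovMeasure_map_mul (μ := μ) g 1
  rw [mul_one] at h1
  rw [dualRep_apply, (hx _).2, ← h1, integral_map hT.aemeasurable
    (preLinfty_measurable f v).aestronglyMeasurable]
  refine integral_congr_ae (((hf g).ae 1).mono fun ω hω => ?_)
  change f.1 ω (πs g⁻¹ v) = f.1 (fun n => g * ω n) v
  rw [hω, dualRep_apply]

theorem integrable_preLinfty (f : preLinfty μ F) (v : F) (g : G) :
    Integrable (fun ω => f.1 ω v) (markovMeasure μ g) :=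
  (weakStarIntegral_spec (preLinfty_exists_integral f g) v).1

theorem RE_isWeakStarIntegral (f : preLinfty μ F) (g : G) :
    IsWeakStarIntegral (markovMeasure μ g) f.1 (RE μ g (toLinfty μ f)) :=
  weakStarIntegral_spec (preLinfty_exists_integral f g)

/-- The coefficients of `x = ∫ f dQ_e` are Poisson integrals, which are harmonic functions; at the
identity this says that `x` is a harmonic vector. -/
theorem integral_mem_harmonicVectors {πs : G →* (F ≃ₗᵢ[ℂ] F)}
    (hπs : ∀ v : F, Continuous fun g => πs g v) {f : preLinfty μ F} (hf : f ∈ preLmuPi μ πs)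
    {x : StrongDual ℂ F} (hx : IsWeakStarIntegral (markovMeasure μ 1) f.1 x) :
    x ∈ harmonicVectors μ πs := by
  intro v
  have hc := continuous_dualRep_apply hπs x v
  refine ⟨Integrable.of_bound hc.measurable.aestronglyMeasurable (‖x‖ * ‖v‖)
    (.of_forall fun g => ((dualRep πs g x).le_opNorm v).trans
      (mul_le_mul_of_nonneg_right (norm_dualRep_le πs g x) (norm_nonneg v))), ?_⟩
  have hh := integral_invariant_harmonic (φ := fun ω => f.1 ω v)
    (preLinfty_measurable f v).stronglyMeasurable (preLinfty_shift f v)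
    (integrable_preLinfty f v) (μ := μ)
    (by simpa only [dualRep_integral_apply hf hx] using hc.measurable.stronglyMeasurable) 1
  simp only [one_mul] at hh
  rw [(hx v).2, ← hh]
  exact integral_congr_ae (.of_forall fun g => (dualRep_integral_apply hf hx g v).symm)

/-- A random variable in `𝕃_{μπ}` is recovered from its integral `x` as the boundary value
`lim π(ωₙ)x`. -/
theorem uae_tendsto_dualRep [TopologicalSpace.SeparableSpace F] {πs : G →* (F ≃ₗᵢ[ℂ] F)}
    (hπs : ∀ v : F, Continuous fun g => πs g v) {f : preLinfty μ F} (hf : f ∈ preLmuPi μ πs)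
    {x : StrongDual ℂ F} (hx : IsWeakStarIntegral (markovMeasure μ 1) f.1 x) :
    UAE μ fun ω => ∀ v, Tendsto (fun n => dualRep πs (ω n) x v) atTop (𝓝 (f.1 ω v)) := by
  have h1 : ∀ v, UAE μ fun ω => Tendsto (fun n => dualRep πs (ω n) x v) atTop (𝓝 (f.1 ω v)) := by
    intro v
    refine ⟨{ω | Tendsto (fun n => dualRep πs (ω n) x v) atTop (𝓝 (f.1 ω v))},
      UnivConull.of_ae ?_ ?_ fun g => ?_, fun ω h => h⟩
    · have hm : ∀ n, Measurable fun ω : ℕ → G => dualRep πs (ω n) x v - f.1 ω v := fun n =>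
        ((continuous_dualRep_apply hπs x v).measurable.comp (measurable_pi_apply n)).sub
          (preLinfty_measurable f v)
      have := measurableSet_tendsto (l := atTop) (𝓝 (0 : ℂ)) hm
      simpa only [tendsto_sub_nhds_zero_iff] using this
    · ext ω
      change Tendsto (fun n => dualRep πs (ω (n + 1)) x v) atTop (𝓝 (f.1 (shift ω) v)) ↔
        Tendsto (fun n => dualRep πs (ω n) x v) atTop (𝓝 (f.1 ω v))
      rw [preLinfty_shift]
      exact tendsto_add_atTop_iff_nat (f := fun n => dualRep πs (ω n) x v) 1
    · have := ae_tendsto_integral (preLinfty_measurable f v) (preLinfty_shift f v)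
        (integrable_preLinfty f v) g
      simpa only [dualRep_integral_apply hf hx, mem_ofPred_eq] using this
  refine (UAE.all fun k => h1 (TopologicalSpace.denseSeq F k)).mono fun ω hω => ?_
  exact tendsto_of_tendsto_denseRange (fun n => norm_dualRep_le πs (ω n) x)
    (TopologicalSpace.denseRange_denseSeq F) hω

/-- `R_π` is isometric: `‖x‖ ≤ ‖f‖_u` since `x` is an average of the values of `f`, and
`‖f‖_u ≤ ‖x‖` since these values are weak* limits of vectors `π(ωₙ)x`. -/
theorem norm_toLinfty_eq [TopologicalSpace.SeparableSpace F] {πs : G →* (F ≃ₗᵢ[ℂ] F)}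
    (hπs : ∀ v : F, Continuous fun g => πs g v) {f : preLinfty μ F} (hf : f ∈ preLmuPi μ πs)
    {x : StrongDual ℂ F} (hx : IsWeakStarIntegral (markovMeasure μ 1) f.1 x) :
    ‖x‖ = ‖toLinfty μ f‖ := by
  rw [norm_toLinfty]
  refine le_antisymm ?_ ?_
  · refine x.opNorm_le_bound ENNReal.toReal_nonneg fun v => ?_
    rw [(hx v).2]
    have hb : ∀ᵐ ω ∂(markovMeasure μ 1), ‖f.1 ω v‖ ≤ (uENorm μ f.1).toReal * ‖v‖ := by
      refine ((uae_le_uENorm f.1).ae 1).mono fun ω hω => ?_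
      refine ((f.1 ω).le_opNorm v).trans (mul_le_mul_of_nonneg_right ?_ (norm_nonneg v))
      rw [← toReal_enorm]
      exact ENNReal.toReal_mono f.2.2.ne hω
    simpa using norm_integral_le_of_norm_le_const hb
  · rw [← toReal_enorm x]
    refine ENNReal.toReal_mono enorm_ne_top (uENorm_le ?_)
    refine (uae_tendsto_dualRep hπs hf hx).mono fun ω hω => ?_
    rw [enorm_le_iff_norm_le]
    exact norm_le_of_weakStar_tendsto (fun n => norm_dualRep_le πs (ω n) x) hω

variable [TopologicalSpace.SeparableSpace F]

theorem measurableSet_convergenceSet {πs : G →* (F ≃ₗᵢ[ℂ] F)}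
    (hπs : ∀ v : F, Continuous fun g => πs g v) (x : StrongDual ℂ F) :
    MeasurableSet (convergenceSet πs x) := by
  rw [convergenceSet_eq]
  exact MeasurableSet.iInter fun k => measurableSet_exists_tendsto fun n =>
    (continuous_dualRep_apply hπs x _).measurable.comp (measurable_pi_apply n)

theorem measurable_boundaryValue {πs : G →* (F ≃ₗᵢ[ℂ] F)}
    (hπs : ∀ v : F, Continuous fun g => πs g v) (x : StrongDual ℂ F) (v : F) :
    Measurable fun ω => boundaryValue πs x ω v := by
  refine measurable_of_tendsto_metrizable (f := fun n => (convergenceSet πs x).indicator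
    fun ω : ℕ → G => dualRep πs (ω n) x v) (fun n => ?_) (tendsto_pi_nhds.2 fun ω => ?_)
  · exact ((continuous_dualRep_apply hπs x v).measurable.comp (measurable_pi_apply n)).indicator
      (measurableSet_convergenceSet hπs x)
  · by_cases h : ω ∈ convergenceSet πs x
    · simpa only [indicator_of_mem h] using boundaryValue_spec h v
    · simp [indicator_of_notMem h, boundaryValue_of_notMem h]

/-- By martingale convergence, `π(ωₙ)x` converges weak* u.a.e. when `x` is harmonic. -/
theorem univConull_convergenceSet {πs : G →* (F ≃ₗᵢ[ℂ] F)}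
    (hπs : ∀ v : F, Continuous fun g => πs g v) {x : StrongDual ℂ F}
    (hx : x ∈ harmonicVectors μ πs) : UnivConull μ (convergenceSet πs x) := by
  have hinv : shift ⁻¹' convergenceSet πs x = convergenceSet πs x := by
    ext ω
    rw [mem_preimage, shift_mem_convergenceSet]
  refine UnivConull.of_ae (measurableSet_convergenceSet hπs x) hinv fun g => ?_
  simp only [convergenceSet_eq, mem_iInter]
  refine ae_all_iff.2 fun k => ?_
  generalize TopologicalSpace.denseSeq F k = v
  exact ae_exists_tendsto (h := fun g => dualRep πs g x v) (C := ‖x‖ * ‖v‖)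
    (continuous_dualRep_apply hπs x v).measurable
    (fun g => (dualRep πs g x).le_of_opNorm_le (norm_dualRep_le πs g x) v)
    (fun g => harmonicVectors_apply hx g v) g

/-- Every harmonic vector is the integral of its boundary value. -/
theorem exists_preLmuPi_integral {πs : G →* (F ≃ₗᵢ[ℂ] F)}
    (hπs : ∀ v : F, Continuous fun g => πs g v) {x : StrongDual ℂ F}
    (hx : x ∈ harmonicVectors μ πs) :
    ∃ f ∈ preLmuPi μ πs, IsWeakStarIntegral (markovMeasure μ 1) f.1 x := by
  have hfin : uENorm μ (boundaryValue πs x) < ∞ :=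
    (uENorm_le (c := ‖x‖ₑ) (UAE.of_forall fun ω =>
      enorm_le_iff_norm_le.2 (norm_boundaryValue_le πs x ω))).trans_lt enorm_lt_top
  let f : preLinfty μ F := ⟨boundaryValue πs x, fun v =>
    measurable_invariants_of_comp_shift (measurable_boundaryValue hπs x v)
      (fun ω => by rw [boundaryValue_shift]), hfin⟩
  refine ⟨f, fun g => ⟨_, univConull_convergenceSet hπs hx, fun ω hω => boundaryValue_mul hω g⟩,
    fun v => ⟨integrable_preLinfty f v 1, ?_⟩⟩
  have hbd : ∀ g, ‖dualRep πs g x v‖ ≤ ‖x‖ * ‖v‖ := fun g =>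
    (dualRep πs g x).le_of_opNorm_le (norm_dualRep_le πs g x) v
  have hm := (continuous_dualRep_apply hπs x v).measurable
  have hC : UAE μ fun ω => ω ∈ convergenceSet πs x :=
    ⟨_, univConull_convergenceSet hπs hx, fun ω hω => hω⟩
  have hlim : Tendsto (fun n => ∫ ω, dualRep πs (ω n) x v ∂(markovMeasure μ 1)) atTop
      (𝓝 (∫ ω, f.1 ω v ∂(markovMeasure μ 1))) :=
    tendsto_integral_of_dominated_convergence (fun _ => ‖x‖ * ‖v‖)
      (fun n => (hm.comp (measurable_pi_apply n)).aestronglyMeasurable) (integrable_const _)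
      (fun n => .of_forall fun ω => hbd (ω n))
      ((hC.ae 1).mono fun ω hω => boundaryValue_spec hω v)
  have hconst : ∀ n, ∫ ω, dualRep πs (ω n) x v ∂(markovMeasure μ 1) = x v := fun n => by
    refine (integral_harmonic (h := fun g => dualRep πs g x v) hm.stronglyMeasurable hbd
      (fun g => harmonicVectors_apply hx g v) 1 n).trans ?_
    rw [dualRep_apply, inv_one, map_one]
    rfl
  simp only [hconst] at hlim
  exact tendsto_nhds_unique tendsto_const_nhds hlim

/-- The Poisson integral `R_π`, as a linear isometry of `𝕃_{μπ}` into the harmonic vectors. -/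
noncomputable def poissonIsometry (μ : Measure G) [IsProbabilityMeasure μ] [μ.Regular]
    (πs : G →* (F ≃ₗᵢ[ℂ] F)) (hπs : ∀ v : F, Continuous fun g => πs g v) :
    LmuPi μ πs →ₗᵢ[ℂ] harmonicVectors μ πs where
  toLinearMap := ((RE μ 1).comp (LmuPi μ πs).subtype).codRestrict (harmonicVectors μ πs) <| by
    rintro ⟨_, f, hf, rfl⟩
    exact integral_mem_harmonicVectors hπs hf (RE_isWeakStarIntegral f 1)
  norm_map' := by
    rintro ⟨_, f, hf, rfl⟩
    exact norm_toLinfty_eq hπs hf (RE_isWeakStarIntegral f 1)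

theorem poissonIsometry_surjective {πs : G →* (F ≃ₗᵢ[ℂ] F)}
    (hπs : ∀ v : F, Continuous fun g => πs g v) :
    Function.Surjective (poissonIsometry μ πs hπs) := by
  rintro ⟨x, hx⟩
  obtain ⟨f, hf, h⟩ := exists_preLmuPi_integral hπs hx
  exact ⟨⟨toLinfty μ f, f, hf, rfl⟩, Subtype.ext ((RE_isWeakStarIntegral f 1).unique h)⟩

end PoissonFormula

end ChoquetDeny

open ChoquetDeny in
theorem theorem6p1 {G : Type*} [Group G] [TopologicalSpace G] [IsTopologicalGroup G]
    [LocallyCompactSpace G] [T2Space G] [MeasurableSpace G] [BorelSpace G]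
    (μ : Measure G) [IsProbabilityMeasure μ] [μ.Regular]
    {F : Type*} [NormedAddCommGroup F] [NormedSpace ℂ F] [CompleteSpace F]
    [TopologicalSpace.SeparableSpace F]
    (πs : G →* (F ≃ₗᵢ[ℂ] F)) (hπs : ∀ v : F, Continuous fun g => πs g v) :
    ∃ R : LmuPi μ πs ≃ₗᵢ[ℂ] harmonicVectors μ πs,
      (∀ f : LmuPi μ πs, (R f : StrongDual ℂ F) = RE μ (1 : G) (f : Linfty μ F)) ∧
      ∀ (x : harmonicVectors μ πs) (f : preLinfty μ F),
        toLinfty μ f = (R.symm x : Linfty μ F) →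
        UAE μ fun ω => Tendsto
          (fun n => StrongDual.toWeakDual (dualRep πs (ω n) (x : StrongDual ℂ F))) atTop
          (𝓝 (StrongDual.toWeakDual (f.1 ω))) := by
  let R := LinearIsometryEquiv.ofSurjective (poissonIsometry μ πs hπs)
    (poissonIsometry_surjective hπs)
  have hR : ∀ f : LmuPi μ πs, (R f : StrongDual ℂ F) = RE μ (1 : G) (f : Linfty μ F) :=
    fun f => rfl
  refine ⟨R, hR, fun x f hf => ?_⟩
  obtain ⟨f', hf', h⟩ := (R.symm x).2
  have hx : IsWeakStarIntegral (markovMeasure μ 1) f'.1 x := by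
    have h1 := RE_isWeakStarIntegral f' 1
    rwa [h, ← hR, R.apply_symm_apply] at h1
  refine ((uae_tendsto_dualRep hπs hf' hx).and (toLinfty_eq_iff.1 (h.trans hf.symm))).mono
    fun ω hω => ?_
  rw [← hω.2]
  exact tendsto_iff_forall_eval_tendsto_topDualPairing.2 hω.1
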